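/- Fix $m\in\mathbb N$. Let $\Sigma_m$ be the space of marked groups: pairs $(\Gamma,S)$ of a group and an ordered generating system $S=(s_1,\dots,s_m)$, up to isomorphism of marked groups, with the metric $d((\Gamma,S),(\Gamma',S'))=2^{-R}$ if the two groups have exactly the same relations of length at most $R$ in their marked generators, while a relation of length $R+1$ holds in only one of them (and distance $0$ if they have the same relations of every length). A group $\Gamma$ is *sofic* if for every $0<\varepsilon<1$ and every finite $F\subseteq\Gamma$ there are $n\ge 1$ and a map $\varphi:\Gamma\to \mathrm{Sym}(n)$ with $\varphi(1)=1$ such that $\varphi(e)\varphi(f)\varphi(ef)^{-1}$ has at least $(1-\varepsilon)n$ fixed points for all $e,f\in F$, and $\varphi(e)$ has at most $\varepsilon n$ fixed points for all $1\neq e\in F$. A matrix $A\in\mathrm{Mat}_{d\times d}(\mathbb Z\Gamma)$ acts on $\ell^2(\Gamma)^d$ by $(Af)_i=\sum_j a_{ij}f_j$, where $\Gamma$ acts on $\ell^2(\Gamma)$ by left translation, and $\dim_\Gamma(\ker A)=\mathrm{Tr}_\Gamma(P)=\sum_{i=1}^d\langle P(\delta_1 e_i),\delta_1 e_i\rangle$,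 where $P$ is the orthogonal projection onto $\ker A$, $\delta_1$ is the characteristic function of the identity, and $\delta_1e_i$ is the vector with $i$-th entry $\delta_1$ and all other entries $0$. The *Atiyah Conjecture* for $\Gamma$ says: if $\Gamma$ is torsion-free, then $\dim_\Gamma(\ker A)\in\mathbb Z$ for every $d$ and every $A\in\mathrm{Mat}_{d\times d}(\mathbb Z\Gamma)$ that is a positive self-adjoint operator. **Theorem.** Let $(\Gamma_n,S_n)_{n}$ be a sequence in $\Sigma_m$ converging to $(\Gamma,S)\in\Sigma_m$, such that every $\Gamma_n$ is torsion-free, sofic and satisfies the Atiyah Conjecture. Then $\Gamma$ is torsion-free and satisfies the Atiyah Conjecture. Moreover, for every $d$ and every matrix $A\in\mathrm{Mat}_{d\times d}(\mathbb Z[F_m])$ over the integral group ring of the free group on $m$ letters, if $A_n\in\mathrm{Mat}_{d\times d}(\mathbb Z\Gamma_n)$ and $A_\infty\in\mathrm{Mat}_{d\times d}(\mathbb Z\Gamma)$ denote the images of $A$ under the marking homomorphisms $F_m\to\Gamma_n$ and $F_m\to\Gamma$, then $$\lim_{n\to\infty}\dim_{\Gamma_n}(\ker A_n)=\dim_\Gamma(\ker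 A_\infty).$$ -/

import Mathlib

open scoped InnerProductSpace ENNReal Topology

universe u

/-! ### Marked groups and the space `Σ_m` -/

/-- A group marked with `m` generators: a group together with an ordered system of `m` elements
(repetitions allowed) that generates it. -/
structure MarkedGroup (m : ℕ) where
  carrier : Type u
  [group : Group carrier]
  gen : Fin m → carrier
  closure_range_gen : Subgroup.closure (Set.range gen) = ⊤

namespace MarkedGroup

attribute [instance] MarkedGroup.group

variable {m : ℕ}

/-- Evaluation of a word in the generators: the marking, as a homomorphism from the free group. -/
def eval (G : MarkedGroup m) : FreeGroup (Fin m) →* G.carrier := FreeGroup.lift G.gen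

/-- Two marked groups have exactly the same relations of length at most `R`. -/
def SameRelations (R : ℕ) (G H : MarkedGroup m) : Prop :=
  ∀ w : FreeGroup (Fin m), w.norm ≤ R → (G.eval w = 1 ↔ H.eval w = 1)

theorem SameRelations.symm {R : ℕ} {G H : MarkedGroup m} (h : SameRelations R G H) :
    SameRelations R H G := fun w hw => (h w hw).symm

theorem SameRelations.trans {R : ℕ} {G H K : MarkedGroup m} (h : SameRelations R G H)
    (h' : SameRelations R H K) : SameRelations R G K := fun w hw => (h w hw).trans (h' w hw)

open Classical in
/-- The distance on `Σ_m`: it is `2 ^ (-R)` if the two marked groups have the same relations of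
length at most `R` while a relation of length `R + 1` holds in only one of them, and it is `0` if
they have the same relations of every length, that is, if they are isomorphic as marked groups. -/
noncomputable def markedDist (G H : MarkedGroup m) : ℝ :=
  if h : ∃ R : ℕ, ¬ SameRelations (R + 1) G H then (1 / 2 : ℝ) ^ Nat.find h else 0

theorem markedDist_nonneg (G H : MarkedGroup m) : 0 ≤ markedDist G H := by
  unfold markedDist
  split_ifs <;> positivity

theorem markedDist_self (G : MarkedGroup m) : markedDist G G = 0 := by
  unfold markedDist
  rw [dif_neg]
  rintro ⟨R, hR⟩
  exact hR fun _ _ => Iff.rfl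

theorem le_markedDist {R : ℕ} {G H : MarkedGroup m} (hR : ¬ SameRelations (R + 1) G H) :
    (1 / 2 : ℝ) ^ R ≤ markedDist G H := by
  classical
  unfold markedDist
  rw [dif_pos ⟨R, hR⟩]
  exact pow_le_pow_of_le_one (by norm_num) (by norm_num) (Nat.find_min' _ hR)

theorem markedDist_le_comm (G H : MarkedGroup m) : markedDist G H ≤ markedDist H G := by
  classical
  by_cases h : ∃ R : ℕ, ¬ SameRelations (R + 1) G H
  · have hd : markedDist G H = (1 / 2 : ℝ) ^ Nat.find h := by
      unfold markedDist
      rw [dif_pos h]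
    rw [hd]
    exact le_markedDist fun h' => Nat.find_spec h h'.symm
  · have hd : markedDist G H = 0 := by
      unfold markedDist
      rw [dif_neg h]
    rw [hd]
    exact markedDist_nonneg H G

theorem markedDist_comm (G H : MarkedGroup m) : markedDist G H = markedDist H G :=
  le_antisymm (markedDist_le_comm G H) (markedDist_le_comm H G)

theorem markedDist_triangle (G H K : MarkedGroup m) :
    markedDist G K ≤ markedDist G H + markedDist H K := by
  classical
  have h1 := markedDist_nonneg G H
  have h2 := markedDist_nonneg H K
  by_cases h : ∃ R : ℕ, ¬ SameRelations (R + 1) G K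
  · have hd : markedDist G K = (1 / 2 : ℝ) ^ Nat.find h := by
      unfold markedDist
      rw [dif_pos h]
    by_cases hGH : SameRelations (Nat.find h + 1) G H
    · have := le_markedDist (fun hHK => Nat.find_spec h (hGH.trans hHK))
      linarith
    · have := le_markedDist hGH
      linarith
  · have hd : markedDist G K = 0 := by
      unfold markedDist
      rw [dif_neg h]
    linarith

/-- The (Gromov-Hausdorff) metric on `Σ_m`. Elements of `Σ_m` are marked groups up to isomorphism
of marked groups, and the elements at distance `0` from a marked group are those isomorphic to it;
so on marked groups themselves this is a pseudometric. -/
noncomputable instance : PseudoMetricSpace (MarkedGroup m) where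
  dist := markedDist
  dist_self := markedDist_self
  dist_comm := markedDist_comm
  dist_triangle := markedDist_triangle

end MarkedGroup

/-! ### Torsion-free groups and sofic groups -/

/-- A group is torsion-free if its only element of finite order is the identity. -/
def GroupTorsionFree (G : Type*) [Group G] : Prop :=
  ∀ g : G, IsOfFinOrder g → g = 1

/-- The number of fixed points of a permutation. -/
noncomputable def numFix {n : ℕ} (σ : Equiv.Perm (Fin n)) : ℕ :=
  {x : Fin n | σ x = x}.ncard

/-- A group is sofic if every finite part of its multiplication table is realized approximately,
and approximately freely, by permutations of a non-empty finite set. -/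
def IsSofic (G : Type*) [Group G] : Prop :=
  ∀ ε : ℝ, 0 < ε → ε < 1 → ∀ F : Finset G,
    ∃ n : ℕ, 0 < n ∧ ∃ φ : G → Equiv.Perm (Fin n),
      (∀ e ∈ F, ∀ f ∈ F, (1 - ε) * n ≤ (numFix (φ e * φ f * (φ (e * f))⁻¹) : ℝ)) ∧
      φ 1 = 1 ∧
      (∀ e ∈ F, e ≠ 1 → (numFix (φ e) : ℝ) ≤ ε * n)

/-! ### Matrices over `ℤΓ` as operators on `ℓ²(Γ)^d` -/

/-- The Hilbert space `ℓ²(Γ)`. -/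
abbrev EllTwo (G : Type*) : Type _ := lp (fun _ : G => ℂ) 2

/-- The Hilbert space `ℓ²(Γ)^d`. -/
abbrev EllTwoPow (G : Type*) (d : ℕ) : Type _ := PiLp 2 (fun _ : Fin d => EllTwo G)

section Translation

variable {G : Type*} [Group G]

theorem memℓp_translate (g : G) (f : EllTwo G) :
    Memℓp (fun x : G => (f (g⁻¹ * x) : ℂ)) 2 := by
  have h := (lp.memℓp f).summable (by norm_num)
  exact memℓp_gen ((Equiv.mulLeft g⁻¹).summable_iff.2 h)

/-- Left translation by `g` on `ℓ²(Γ)`, `(g f)(x) = f(g⁻¹ x)`, as a linear map. -/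
noncomputable def translateLin (g : G) : EllTwo G →ₗ[ℂ] EllTwo G where
  toFun f := ⟨fun x => f (g⁻¹ * x), memℓp_translate g f⟩
  map_add' _ _ := by ext; rfl
  map_smul' _ _ := by ext; rfl

theorem translateLin_apply (g : G) (f : EllTwo G) (x : G) :
    translateLin g f x = f (g⁻¹ * x) := rfl

theorem norm_translateLin (g : G) (f : EllTwo G) : ‖translateLin g f‖ = ‖f‖ := by
  rw [lp.norm_eq_tsum_rpow (by norm_num), lp.norm_eq_tsum_rpow (by norm_num)]
  congr 1
  exact (Equiv.mulLeft g⁻¹).tsum_eq (fun x => ‖f x‖ ^ (2 : ℝ≥0∞).toReal)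

/-- The left regular representation of `Γ` on `ℓ²(Γ)`: `(leftRegular g f)(x) = f(g⁻¹ x)`. -/
noncomputable def leftRegular (G : Type*) [Group G] : G →* (EllTwo G →L[ℂ] EllTwo G) where
  toFun g := (translateLin g).mkContinuous 1 fun f => by rw [norm_translateLin, one_mul]
  map_one' := by
    ext f x
    simp [translateLin_apply]
  map_mul' g h := by
    ext f x
    simp [translateLin_apply, mul_assoc]

/-- The action of the integral group ring on `ℓ²(Γ)`, `∑ c_g g ↦ ∑ c_g (leftRegular g)`. -/
noncomputable def groupRingRep (G : Type*) [Group G] :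
    MonoidAlgebra ℤ G →ₐ[ℤ] (EllTwo G →L[ℂ] EllTwo G) :=
  MonoidAlgebra.lift ℤ (EllTwo G →L[ℂ] EllTwo G) G (leftRegular G)

/-- The operator on `ℓ²(Γ)^d` given by a `d × d` matrix over `ℤΓ`:
`(A f)_i = ∑ j, a_{ij} f_j`. -/
noncomputable def matrixOp {d : ℕ} (A : Matrix (Fin d) (Fin d) (MonoidAlgebra ℤ G)) :
    EllTwoPow G d →L[ℂ] EllTwoPow G d :=
  ((PiLp.continuousLinearEquiv 2 ℂ (fun _ : Fin d => EllTwo G)).symm :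
      (Fin d → EllTwo G) →L[ℂ] EllTwoPow G d) ∘L
    ContinuousLinearMap.pi fun i =>
      ∑ j, groupRingRep G (A i j) ∘L PiLp.proj 2 (fun _ : Fin d => EllTwo G) j

end Translation

/-! ### Trace, von Neumann dimension, and the Atiyah Conjecture -/

section Dimension

variable {G : Type*} [Group G]

open Classical in
/-- The vector of `ℓ²(Γ)^d` whose `i`-th entry is the characteristic function of the identity of
`Γ`, and whose other entries are zero. -/
noncomputable def unitVec {d : ℕ} (i : Fin d) : EllTwoPow G d :=
  PiLp.single 2 i (lp.single 2 (1 : G) (1 : ℂ))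

/-- The trace `Tr_Γ(T) = ∑ i, Tr_Γ(T_{ii})` of `d × d` matrices over the group von Neumann algebra,
where `Tr_Γ(a) = ⟨a δ_1, δ_1⟩`. The formula is written for all bounded operators on `ℓ²(Γ)^d`; it is
used for elements of `Mat_{d × d}(NΓ)`, that is, for operators commuting with right translations. -/
noncomputable def vnTrace {d : ℕ} (T : EllTwoPow G d →L[ℂ] EllTwoPow G d) : ℂ :=
  ∑ i : Fin d, ⟪unitVec i, T (unitVec i)⟫_ℂ

/-- The orthogonal projection onto the kernel of an operator. -/
noncomputable def kerProj {d : ℕ} (T : EllTwoPow G d →L[ℂ] EllTwoPow G d) :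
    EllTwoPow G d →L[ℂ] EllTwoPow G d :=
  haveI : CompleteSpace (LinearMap.ker T.toLinearMap) := T.isClosed_ker.completeSpace_coe
  (LinearMap.ker T.toLinearMap).starProjection

/-- The von Neumann dimension `dim_Γ(ker A)` of the kernel of a matrix over `ℤΓ`: the trace of the
orthogonal projection onto it. It is a real number, as the trace of a projection. -/
noncomputable def vnDimKer {d : ℕ} (A : Matrix (Fin d) (Fin d) (MonoidAlgebra ℤ G)) : ℝ :=
  (vnTrace (kerProj (matrixOp A))).re

/-- The Atiyah Conjecture for `Γ`: if `Γ` is torsion-free and `A` is a square matrix over `ℤΓ`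
that is positive and self-adjoint as an operator, then `dim_Γ(ker A)` is an integer. -/
def AtiyahConjecture (G : Type*) [Group G] : Prop :=
  GroupTorsionFree G →
    ∀ (d : ℕ) (A : Matrix (Fin d) (Fin d) (MonoidAlgebra ℤ G)),
      IsSelfAdjoint (matrixOp A) → (matrixOp A).IsPositive → ∃ k : ℤ, vnDimKer A = k

end Dimension

/-- The matrix over `ℤΓ` obtained from a matrix over the integral group ring of the free group on
`m` letters by evaluating the words in its entries at the generators of a marked group. -/
noncomputable def MarkedGroup.evalMatrix {m d : ℕ} (G : MarkedGroup m)
    (A : Matrix (Fin d) (Fin d) (MonoidAlgebra ℤ (FreeGroup (Fin m)))) :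
    Matrix (Fin d) (Fin d) (MonoidAlgebra ℤ G.carrier) :=
  A.map (MonoidAlgebra.mapDomainRingHom ℤ G.eval)

set_option linter.unusedSectionVars false

/-! ### Integer matrices: small eigenvalues are rare -/

/-! This is Lück's approximation argument. Fix `A` over the free group ring and a large `K`. The
moments `τ((1 - A*A/K)^k)`, with `τ` the trace pulled back from a marked group, tend to the
dimension of the kernel as `k → ∞`. For fixed `k` a moment involves finitely many words, so along a
convergent sequence of marked groups it is eventually constant. Everything thus rests on
interchanging two limits, that is, on a rate in `k` that does not depend on the group.

The rate comes from integrality. The non-zero eigenvalues of a positive semidefinite integer matrix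
have product at least one, so if all are at most `K`, at most a proportion `1/j` of them lies in
`(0, K^(-j))` (`mul_card_small_le`). Soficity approximates any finite set of moments by normalized
traces of integer matrices built from permutations, so the rate holds in every sofic group
(`exists_forall_abs_moment_kerIndicator_sub_le`). The limit group inherits it because its moments
are eventual values of those of the `Γ n`.

The mean ergodic theorem identifies the limit of the moments: their Cesàro averages tend to the
dimension, and the rate makes the moments themselves converge. Integrality passes to the limit
because `ℤ` is closed in `ℝ`. A lift of a positive matrix need not be positive over `Γ n`, so the
conjecture is applied there to `A*A`, which has the same kernel as `A`. -/

theorem trailingCoeff_map_intCast (p : Polynomial ℤ) :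
    (p.map (Int.castRingHom ℝ)).trailingCoeff = (p.trailingCoeff : ℝ) := by
  have hinj : Function.Injective (Int.castRingHom ℝ) := Int.cast_injective
  by_cases hp : p = 0
  · simp [hp]
  · have hp' : p.map (Int.castRingHom ℝ) ≠ 0 := (Polynomial.map_ne_zero_iff hinj).2 hp
    have hdeg : (p.map (Int.castRingHom ℝ)).natTrailingDegree = p.natTrailingDegree := by
      simp only [Polynomial.natTrailingDegree_eq_support_min' hp,
        Polynomial.natTrailingDegree_eq_support_min' hp', Polynomial.support_map_of_injective p hinj]
    rw [Polynomial.trailingCoeff, Polynomial.trailingCoeff, Polynomial.coeff_map, hdeg]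
    simp

theorem trailingCoeff_X_sub_C (a : ℝ) :
    (Polynomial.X - Polynomial.C a).trailingCoeff = if a = 0 then 1 else -a := by
  split_ifs with h
  · subst h
    simp [Polynomial.trailingCoeff, Polynomial.natTrailingDegree_X]
  · rw [Polynomial.trailingCoeff_eq_coeff_zero] <;> simp [h]

theorem trailingCoeff_finset_prod {ι : Type*} (s : Finset ι) (f : ι → Polynomial ℝ) :
    (∏ i ∈ s, f i).trailingCoeff = ∏ i ∈ s, (f i).trailingCoeff := by
  classical
  induction s using Finset.induction_on with
  | empty => simpa using (Polynomial.trailingCoeff_eq_coeff_zero (p := (1 : Polynomial ℝ)) (by simp))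
  | insert a s ha ih => rw [Finset.prod_insert ha, Finset.prod_insert ha,
      Polynomial.trailingCoeff_mul, ih]

section

variable {ι : Type*} [Fintype ι] [DecidableEq ι]

/-- The product of the non-zero eigenvalues of a positive semidefinite integer matrix is at
least one. -/
theorem one_le_prod_nonzero_eigenvalues (M : Matrix ι ι ℤ)
    (hM : (M.map (Int.castRingHom ℝ)).IsHermitian) (h0 : ∀ i, 0 ≤ hM.eigenvalues i) :
    1 ≤ ∏ i, (if hM.eigenvalues i = 0 then 1 else hM.eigenvalues i) := by
  -- Trailing coefficients are multiplicative, so that of the characteristic polynomial is, up to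
  -- sign, the product of the non-zero eigenvalues. It is also a non-zero integer.
  have h1 := congrArg Polynomial.trailingCoeff hM.charpoly_eq
  rw [Matrix.charpoly_map, trailingCoeff_map_intCast, trailingCoeff_finset_prod] at h1
  have h2 : (1 : ℝ) ≤ |(M.charpoly.trailingCoeff : ℝ)| := by
    have : M.charpoly.trailingCoeff ≠ 0 :=
      Polynomial.trailingCoeff_nonzero_iff_nonzero.2 M.charpoly_monic.ne_zero
    exact_mod_cast Int.one_le_abs this
  rw [h1, Finset.abs_prod] at h2
  refine h2.trans_eq (Finset.prod_congr rfl fun i _ => ?_)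
  rw [RCLike.ofReal_real_eq_id, id, trailingCoeff_X_sub_C]
  split_ifs with h
  · simp
  · rw [abs_neg, abs_of_nonneg (h0 i)]

/-- Bound the small factors by `K^(1-j)` and all others by `K`: the product is at most `K^(card ι -
j * card s)`, and it is at least one. The spare factor `K` on the small terms only makes the
exponents easy to count. -/
theorem mul_card_small_le {K : ℝ} (hK : 1 < K) {lam : ι → ℝ} (h0 : ∀ i, 0 ≤ lam i)
    (hlam : ∀ i, lam i ≤ K) (hprod : 1 ≤ ∏ i, (if lam i = 0 then 1 else lam i)) (j : ℕ) :
    j * (Finset.univ.filter fun i => 0 < lam i ∧ lam i < (K ^ j)⁻¹).card ≤ Fintype.card ι := by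
  set s := Finset.univ.filter fun i => 0 < lam i ∧ lam i < (K ^ j)⁻¹ with hs
  have hK0 : 0 < K := by linarith
  have h : ∏ i, (if lam i = 0 then 1 else lam i) ≤
      ∏ i, (if i ∈ s then (K ^ j)⁻¹ * K else K) := by
    refine Finset.prod_le_prod (fun i _ => ?_) (fun i _ => ?_)
    · split_ifs
      · exact zero_le_one
      · exact h0 i
    · by_cases hi : i ∈ s
      · have hi' := (Finset.mem_filter.1 hi).2
        rw [if_neg hi'.1.ne', if_pos hi]
        refine hi'.2.le.trans (le_mul_of_one_le_right (by positivity) hK.le)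
      · rw [if_neg hi]
        split_ifs
        · exact hK.le
        · exact hlam i
  have h2 : ∏ i, (if i ∈ s then (K ^ j)⁻¹ * K else K) =
      ((K ^ j)⁻¹) ^ s.card * K ^ Fintype.card ι := by
    have : ∀ i, (if i ∈ s then (K ^ j)⁻¹ * K else K) = (if i ∈ s then (K ^ j)⁻¹ else 1) * K := by
      intro i; split_ifs <;> simp
    simp only [this, Finset.prod_mul_distrib, Finset.prod_const, Finset.card_univ]
    rw [Finset.prod_ite_mem, Finset.univ_inter, Finset.prod_const]
  have h3 := hprod.trans h
  rw [h2, inv_pow, ← pow_mul, inv_mul_eq_div, one_le_div (by positivity)] at h3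
  exact (pow_le_pow_iff_right₀ hK).1 h3

/-- Zero eigenvalues cancel; eigenvalues below `K^(-j)` cost at most `1` each but are at most `card
ι / j ≤ (η/2) card ι` in number; each remaining one costs at most `η/2` by the choice of `k`. -/
theorem abs_sum_pow_sub_le {K : ℝ} (hK : 1 < K) {lam : ι → ℝ} (h0 : ∀ i, 0 ≤ lam i)
    (hlam : ∀ i, lam i ≤ K) (hprod : 1 ≤ ∏ i, (if lam i = 0 then 1 else lam i))
    {η : ℝ} {j k k' : ℕ} (hj : 2 ≤ η * j) (hη : 0 < η)
    (hk : (1 - (K ^ j)⁻¹ / K) ^ k ≤ η / 2) (hkk : k ≤ k') :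
    |∑ i, (1 - lam i / K) ^ k - ∑ i, (1 - lam i / K) ^ k'| ≤ η * Fintype.card ι := by
  have hK0 : 0 < K := by linarith
  set s := Finset.univ.filter fun i => 0 < lam i ∧ lam i < (K ^ j)⁻¹ with hs
  have hcard := mul_card_small_le hK h0 hlam hprod j
  rw [← hs] at hcard
  have hx0 : ∀ i, 0 ≤ 1 - lam i / K := fun i => by
    have := (div_le_one hK0).2 (hlam i); linarith
  have hx1 : ∀ i, 1 - lam i / K ≤ 1 := fun i => by
    have := div_nonneg (h0 i) hK0.le; linarith
  have hb0 : 0 ≤ (1 - (K ^ j)⁻¹ / K) := by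
    have h1 : (K ^ j)⁻¹ ≤ 1 := inv_le_one_of_one_le₀ (one_le_pow₀ hK.le)
    have := (div_le_one hK0).2 (h1.trans hK.le)
    linarith
  rw [← Finset.sum_sub_distrib, abs_of_nonneg (Finset.sum_nonneg fun i _ =>
    sub_nonneg.2 (pow_le_pow_of_le_one (hx0 i) (hx1 i) hkk))]
  have hterm : ∀ i, (1 - lam i / K) ^ k - (1 - lam i / K) ^ k' ≤
      (if i ∈ s then (1 : ℝ) else 0) + η / 2 := by
    intro i
    have hk0 := pow_nonneg (hx0 i) k'
    have hk1 := pow_le_one₀ (n := k) (hx0 i) (hx1 i)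
    by_cases hi : i ∈ s
    · rw [if_pos hi]; linarith
    · rw [if_neg hi]
      rcases (h0 i).eq_or_lt with hi0 | hi0
      · rw [← hi0]; simp; linarith
      · have hi2 : (K ^ j)⁻¹ ≤ lam i := by
          by_contra hlt
          exact hi (Finset.mem_filter.2 ⟨Finset.mem_univ _, hi0, not_le.1 hlt⟩)
        have : (1 - lam i / K) ^ k ≤ (1 - (K ^ j)⁻¹ / K) ^ k := by
          apply pow_le_pow_left₀ (hx0 i)
          have := div_le_div_of_nonneg_right hi2 hK0.le
          linarith
        linarith
  refine (Finset.sum_le_sum fun i _ => hterm i).trans ?_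
  rw [Finset.sum_add_distrib, Finset.sum_ite_mem, Finset.univ_inter, Finset.sum_const,
    Finset.sum_const, Finset.card_univ, nsmul_eq_mul, nsmul_eq_mul, mul_one]
  have hc : (j : ℝ) * s.card ≤ Fintype.card ι := by exact_mod_cast hcard
  nlinarith [mul_le_mul_of_nonneg_left hc hη.le, mul_le_mul_of_nonneg_right hj (Nat.cast_nonneg (α := ℝ) s.card)]

theorem eigenvalues_le_of_row_sum_le {A : Matrix ι ι ℝ} (hA : A.IsHermitian) {K : ℝ}
    (hrow : ∀ i, ∑ j, |A i j| ≤ K) (a : ι) : hA.eigenvalues a ≤ K := by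
  have hv := hA.mulVec_eigenvectorBasis a
  set v : ι → ℝ := ⇑(hA.eigenvectorBasis a) with hvdef
  -- Read the eigenvalue equation at a coordinate where the eigenvector is largest in absolute
  -- value.
  obtain ⟨i, -, hi⟩ := Finset.exists_max_image Finset.univ (fun i => |v i|) ⟨a, Finset.mem_univ _⟩
  have hvi : 0 < |v i| := by
    rw [abs_pos]
    intro h
    have hz : hA.eigenvectorBasis a = 0 := by
      ext b
      have hb := hi b (Finset.mem_univ _)
      rw [h, abs_zero] at hb
      exact abs_nonpos_iff.1 hb
    exact hA.eigenvectorBasis.toBasis.ne_zero a (by simpa using hz)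
  have h1 := congrFun hv i
  simp only [Matrix.mulVec, dotProduct, Pi.smul_apply, smul_eq_mul] at h1
  have h2 : |hA.eigenvalues a| * |v i| ≤ K * |v i| := by
    rw [← abs_mul, ← h1]
    refine (Finset.abs_sum_le_sum_abs _ _).trans ?_
    refine (Finset.sum_le_sum (g := fun j => |A i j| * |v i|) fun j _ => ?_).trans ?_
    · rw [abs_mul]
      exact mul_le_mul_of_nonneg_left (hi j (Finset.mem_univ _)) (abs_nonneg _)
    · rw [← Finset.sum_mul]
      exact mul_le_mul_of_nonneg_right (hrow i) hvi.le
  exact (le_abs_self _).trans (le_of_mul_le_mul_right h2 hvi)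

theorem trace_sub_pow_eq_sum {A : Matrix ι ι ℝ} (hA : A.IsHermitian) (c : ℝ) (k : ℕ) :
    ((c • (1 : Matrix ι ι ℝ) - A) ^ k).trace = ∑ i, (c - hA.eigenvalues i) ^ k := by
  have h : c • (1 : Matrix ι ι ℝ) - A = Unitary.conjStarAlgAut ℝ _ hA.eigenvectorUnitary
      (Matrix.diagonal fun i => c - hA.eigenvalues i) := by
    have h1 : (Matrix.diagonal fun i => c - hA.eigenvalues i) =
        c • (1 : Matrix ι ι ℝ) - Matrix.diagonal (RCLike.ofReal ∘ hA.eigenvalues) := by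
      ext i j
      by_cases hij : i = j <;> simp [hij]
    rw [h1, map_sub, map_smul, map_one, ← hA.spectral_theorem]
  rw [h, ← map_pow, Unitary.conjStarAlgAut_apply, Matrix.trace_mul_cycle, Unitary.coe_star_mul_self,
    one_mul, Matrix.diagonal_pow, Matrix.trace_diagonal]
  rfl

end

/-- Normalized traces of high powers of `1 - M / K` are close to each other, uniformly in all
positive semidefinite integer matrices `M` with absolute row sums at most `K`. -/
theorem exists_forall_abs_trace_pow_sub_le {K : ℝ} (hK : 1 < K) {η : ℝ} (hη : 0 < η) :
    ∃ k₀ : ℕ, ∀ k k' : ℕ, k₀ ≤ k → k₀ ≤ k' → ∀ (ι : Type) [Fintype ι] [DecidableEq ι]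
      (M : Matrix ι ι ℤ), (M.map (Int.castRingHom ℝ)).PosSemidef →
      (∀ i, ∑ j, |(M i j : ℝ)| ≤ K) →
      |((K • (1 : Matrix ι ι ℝ) - M.map (Int.castRingHom ℝ)) ^ k).trace / K ^ k -
        ((K • (1 : Matrix ι ι ℝ) - M.map (Int.castRingHom ℝ)) ^ k').trace / K ^ k'| ≤
        η * Fintype.card ι := by
  have hK0 : 0 < K := by linarith
  obtain ⟨j, hj⟩ := exists_nat_ge (2 / η)
  rw [div_le_iff₀' hη] at hj
  have hb0 : 0 ≤ (1 - (K ^ j)⁻¹ / K) := by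
    have h1 : (K ^ j)⁻¹ ≤ 1 := inv_le_one_of_one_le₀ (one_le_pow₀ hK.le)
    have := (div_le_one hK0).2 (h1.trans hK.le)
    linarith
  have hb1 : (1 - (K ^ j)⁻¹ / K) < 1 := by
    have : 0 < (K ^ j)⁻¹ / K := by positivity
    linarith
  obtain ⟨k₀, hk₀⟩ := exists_pow_lt_of_lt_one (half_pos hη) hb1
  have hall : ∀ k, k₀ ≤ k → (1 - (K ^ j)⁻¹ / K) ^ k ≤ η / 2 := fun k hk =>
    (pow_le_pow_of_le_one hb0 hb1.le hk).trans hk₀.le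
  refine ⟨k₀, fun k k' hk hk' ι _ _ M hM hrow => ?_⟩
  have hH := hM.isHermitian
  have htr : ∀ k, ((K • (1 : Matrix ι ι ℝ) - M.map (Int.castRingHom ℝ)) ^ k).trace / K ^ k =
      ∑ i, (1 - hH.eigenvalues i / K) ^ k := by
    intro k
    rw [trace_sub_pow_eq_sum hH, Finset.sum_div]
    refine Finset.sum_congr rfl fun i _ => ?_
    rw [← div_pow, sub_div, div_self hK0.ne']
  rw [htr, htr]
  have hprod := one_le_prod_nonzero_eigenvalues M hH hM.eigenvalues_nonneg
  have hle := eigenvalues_le_of_row_sum_le hH (K := K) (by simpa using hrow)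
  rcases le_total k k' with h | h
  · exact abs_sum_pow_sub_le hK hM.eigenvalues_nonneg hle hprod hj hη (hall k hk) h
  · rw [abs_sub_comm]
    exact abs_sum_pow_sub_le hK hM.eigenvalues_nonneg hle hprod hj hη (hall k' hk') h

/-! ### Matrices over the integral group ring -/

section GroupRing

variable {G H : Type*} [Group G] [Group H] {d : ℕ}

/-- The formal adjoint of a matrix over an integral group ring. -/
noncomputable def adjointMatrix (A : Matrix (Fin d) (Fin d) (MonoidAlgebra ℤ G)) :
    Matrix (Fin d) (Fin d) (MonoidAlgebra ℤ G) :=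
  Matrix.of fun i j => MonoidAlgebra.mapDomain (fun g => g⁻¹) (A j i)

theorem adjointMatrix_map (f : G →* H) (A : Matrix (Fin d) (Fin d) (MonoidAlgebra ℤ G)) :
    adjointMatrix (A.map (MonoidAlgebra.mapDomainRingHom ℤ f)) =
      (adjointMatrix A).map (MonoidAlgebra.mapDomainRingHom ℤ f) := by
  ext1 i j
  simp only [adjointMatrix, Matrix.map_apply, Matrix.of_apply]
  induction A j i using MonoidAlgebra.induction_linear with
  | zero => simp
  | add x y hx hy => simp_all [MonoidAlgebra.mapDomain_add]
  | single g c => simp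

/-- The `ℓ¹`-norm of an element of an integral group ring. -/
noncomputable def lOneNorm (x : MonoidAlgebra ℤ G) : ℝ := x.coeff.sum fun _ c => |(c : ℝ)|

theorem lOneNorm_nonneg (x : MonoidAlgebra ℤ G) : 0 ≤ lOneNorm x :=
  Finset.sum_nonneg fun _ _ => abs_nonneg _

/-- The sum of the `ℓ¹`-norms of the entries of a matrix. -/
noncomputable def matrixLOneNorm (A : Matrix (Fin d) (Fin d) (MonoidAlgebra ℤ G)) : ℝ :=
  ∑ i, ∑ j, lOneNorm (A i j)

theorem matrixLOneNorm_nonneg (A : Matrix (Fin d) (Fin d) (MonoidAlgebra ℤ G)) :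
    0 ≤ matrixLOneNorm A :=
  Finset.sum_nonneg fun _ _ => Finset.sum_nonneg fun _ _ => lOneNorm_nonneg _

/-- The trace on matrices over the group ring induced by a function on the group. -/
noncomputable def traceOf (τ : G → ℝ) (A : Matrix (Fin d) (Fin d) (MonoidAlgebra ℤ G)) : ℝ :=
  ∑ i, MonoidAlgebra.liftNC (Int.castAddHom ℝ) τ (A i i)

theorem abs_liftNC_sub_le {τ τ' : G → ℝ} {δ : ℝ} {x : MonoidAlgebra ℤ G}
    (h : ∀ g ∈ x.coeff.support, |τ g - τ' g| ≤ δ) :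
    |MonoidAlgebra.liftNC (Int.castAddHom ℝ) τ x - MonoidAlgebra.liftNC (Int.castAddHom ℝ) τ' x| ≤
      δ * lOneNorm x := by
  have key : ∀ σ : G → ℝ, MonoidAlgebra.liftNC (Int.castAddHom ℝ) σ x =
      ∑ g ∈ x.coeff.support, (x.coeff g : ℝ) * σ g := by
    intro σ
    conv_lhs => rw [← MonoidAlgebra.sum_coeff_single x]
    rw [Finsupp.sum, map_sum]
    simp
  rw [key, key, ← Finset.sum_sub_distrib, lOneNorm, Finsupp.sum, Finset.mul_sum]
  refine (Finset.abs_sum_le_sum_abs _ _).trans (Finset.sum_le_sum fun g hg => ?_)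
  rw [← mul_sub, abs_mul, mul_comm]
  exact mul_le_mul_of_nonneg_right (h g hg) (abs_nonneg _)

theorem abs_traceOf_sub_le {τ τ' : G → ℝ} {δ : ℝ}
    {A : Matrix (Fin d) (Fin d) (MonoidAlgebra ℤ G)}
    (h : ∀ i, ∀ g ∈ (A i i).coeff.support, |τ g - τ' g| ≤ δ) :
    |traceOf τ A - traceOf τ' A| ≤ δ * ∑ i, lOneNorm (A i i) := by
  rw [traceOf, traceOf, ← Finset.sum_sub_distrib, Finset.mul_sum]
  exact (Finset.abs_sum_le_sum_abs _ _).trans (Finset.sum_le_sum fun i _ => abs_liftNC_sub_le (h i))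

theorem traceOf_congr {τ τ' : G → ℝ} {A : Matrix (Fin d) (Fin d) (MonoidAlgebra ℤ G)}
    (h : ∀ i, ∀ g ∈ (A i i).coeff.support, τ g = τ' g) : traceOf τ A = traceOf τ' A := by
  have := abs_traceOf_sub_le (τ := τ) (τ' := τ') (A := A) (δ := 0)
    fun i g hg => by rw [h i g hg, sub_self, abs_zero]
  rw [zero_mul] at this
  exact sub_eq_zero.1 (abs_nonpos_iff.1 this)

theorem traceOf_div (τ : G → ℝ) (c : ℝ) (A : Matrix (Fin d) (Fin d) (MonoidAlgebra ℤ G)) :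
    traceOf (fun g => τ g / c) A = traceOf τ A / c := by
  rw [traceOf, traceOf, Finset.sum_div]
  refine Finset.sum_congr rfl fun i _ => ?_
  induction A i i using MonoidAlgebra.induction_linear with
  | zero => simp
  | add x y hx hy => rw [map_add, map_add, hx, hy, add_div]
  | single g c => simp [mul_div_assoc]

end GroupRing

/-! ### Permutation matrices -/

section Permutation

variable {G : Type*} [Group G] {d n : ℕ}

/-- The representation of the symmetric group by permutation matrices. -/
def permRep (n : ℕ) : Equiv.Perm (Fin n) →* Matrix (Fin n) (Fin n) ℤ where
  -- `permMatrix` reverses products; the inverse restores the order.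
  toFun σ := (σ⁻¹).permMatrix ℤ
  map_one' := by simp
  map_mul' σ τ := by rw [mul_inv_rev, Matrix.permMatrix_mul]

theorem permRep_inv (σ : Equiv.Perm (Fin n)) : permRep n σ⁻¹ = (permRep n σ).transpose := by
  simp [permRep]

theorem trace_permRep (σ : Equiv.Perm (Fin n)) : (permRep n σ).trace = numFix σ := by
  simp only [permRep, MonoidHom.coe_mk, OneHom.coe_mk, Matrix.trace_permutation, numFix]
  congr 2
  ext x
  simp [Function.mem_fixedPoints, Function.IsFixedPt, eq_comm]

theorem row_sum_permRep (σ : Equiv.Perm (Fin n)) (a : Fin n) :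
    ∑ b, |((permRep n σ a b : ℤ) : ℝ)| = 1 := by
  have : ∀ b, |((permRep n σ a b : ℤ) : ℝ)| = if b = σ⁻¹ a then 1 else 0 := by
    intro b
    simp only [permRep, MonoidHom.coe_mk, OneHom.coe_mk, Equiv.Perm.permMatrix,
      PEquiv.toMatrix_apply, Equiv.toPEquiv_apply, Option.mem_some_iff]
    by_cases h : b = σ⁻¹ a
    · simp [h]
    · rw [if_neg h, if_neg (fun h' => h h'.symm)]; simp
  simp [this]

/-- The linear extension of an action by permutations to the integral group ring. -/
noncomputable def permAlg (ψ : G →* Equiv.Perm (Fin n)) :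
    MonoidAlgebra ℤ G →ₐ[ℤ] Matrix (Fin n) (Fin n) ℤ :=
  MonoidAlgebra.lift ℤ (Matrix (Fin n) (Fin n) ℤ) G ((permRep n).comp ψ)

theorem permAlg_single (ψ : G →* Equiv.Perm (Fin n)) (g : G) (c : ℤ) :
    permAlg ψ (MonoidAlgebra.single g c) = c • permRep n (ψ g) := by
  simp [permAlg]

theorem permAlg_mapDomain_inv (ψ : G →* Equiv.Perm (Fin n)) (x : MonoidAlgebra ℤ G) :
    permAlg ψ (MonoidAlgebra.mapDomain (fun g => g⁻¹) x) = (permAlg ψ x).transpose := by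
  induction x using MonoidAlgebra.induction_linear with
  | zero => simp
  | add x y hx hy => rw [MonoidAlgebra.mapDomain_add, map_add, map_add, hx, hy,
      Matrix.transpose_add]
  | single g c => rw [MonoidAlgebra.mapDomain_single, permAlg_single, permAlg_single, map_inv,
      permRep_inv, Matrix.transpose_smul]

theorem trace_permAlg (ψ : G →* Equiv.Perm (Fin n)) (x : MonoidAlgebra ℤ G) :
    ((permAlg ψ x).trace : ℝ) =
      MonoidAlgebra.liftNC (Int.castAddHom ℝ) (fun g => (numFix (ψ g) : ℝ)) x := by
  induction x using MonoidAlgebra.induction_linear with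
  | zero => simp
  | add x y hx hy => rw [map_add, map_add, Matrix.trace_add, Int.cast_add, hx, hy]
  | single g c =>
    rw [permAlg_single, Matrix.trace_smul, trace_permRep, MonoidAlgebra.liftNC_single]
    simp

theorem row_sum_permAlg_le (ψ : G →* Equiv.Perm (Fin n)) (x : MonoidAlgebra ℤ G) (a : Fin n) :
    ∑ b, |((permAlg ψ x a b : ℤ) : ℝ)| ≤ lOneNorm x := by
  have h : ∀ b, |((permAlg ψ x a b : ℤ) : ℝ)| ≤
      ∑ g ∈ x.coeff.support, |(x.coeff g : ℝ)| * |((permRep n (ψ g) a b : ℤ) : ℝ)| := by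
    intro b
    rw [permAlg, MonoidAlgebra.lift_apply, Finsupp.sum, Matrix.sum_apply, Int.cast_sum]
    refine (Finset.abs_sum_le_sum_abs _ _).trans (Finset.sum_le_sum fun g _ => ?_)
    simp [abs_mul]
  refine (Finset.sum_le_sum fun b _ => h b).trans ?_
  rw [Finset.sum_comm]
  simp only [← Finset.mul_sum, row_sum_permRep, mul_one]
  exact le_rfl

/-- The block matrix obtained by letting the group ring act on each entry by permutations. -/
noncomputable def permMatrixHom (d : ℕ) (ψ : G →* Equiv.Perm (Fin n)) :
    Matrix (Fin d) (Fin d) (MonoidAlgebra ℤ G) →+* Matrix (Fin d × Fin n) (Fin d × Fin n) ℤ :=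
  (Matrix.compRingEquiv (Fin d) (Fin n) ℤ : _ →+* _).comp (permAlg ψ).toRingHom.mapMatrix

theorem permMatrixHom_apply (ψ : G →* Equiv.Perm (Fin n))
    (A : Matrix (Fin d) (Fin d) (MonoidAlgebra ℤ G)) (p q : Fin d × Fin n) :
    permMatrixHom d ψ A p q = permAlg ψ (A p.1 q.1) p.2 q.2 := rfl

theorem permMatrixHom_adjointMatrix (ψ : G →* Equiv.Perm (Fin n))
    (A : Matrix (Fin d) (Fin d) (MonoidAlgebra ℤ G)) :
    permMatrixHom d ψ (adjointMatrix A) = (permMatrixHom d ψ A).transpose := by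
  ext p q
  simp [permMatrixHom_apply, adjointMatrix, permAlg_mapDomain_inv]

theorem trace_permMatrixHom (ψ : G →* Equiv.Perm (Fin n))
    (A : Matrix (Fin d) (Fin d) (MonoidAlgebra ℤ G)) :
    ((permMatrixHom d ψ A).trace : ℝ) = traceOf (fun g => (numFix (ψ g) : ℝ)) A := by
  simp only [traceOf, ← trace_permAlg, Matrix.trace, Matrix.diag, permMatrixHom_apply,
    Fintype.sum_prod_type, Int.cast_sum]

theorem row_sum_permMatrixHom_le (ψ : G →* Equiv.Perm (Fin n))
    (A : Matrix (Fin d) (Fin d) (MonoidAlgebra ℤ G)) (p : Fin d × Fin n) :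
    ∑ q, |((permMatrixHom d ψ A p q : ℤ) : ℝ)| ≤ matrixLOneNorm A := by
  simp only [permMatrixHom_apply, Fintype.sum_prod_type]
  refine (Finset.sum_le_sum fun j _ => row_sum_permAlg_le ψ (A p.1 j) p.2).trans ?_
  exact Finset.single_le_sum (f := fun i => ∑ j, lOneNorm (A i j))
    (fun i _ => Finset.sum_nonneg fun j _ => lOneNorm_nonneg _) (Finset.mem_univ p.1)

/-- The normalized trace of the `k`-th power of `1 - A* A / K`, for the trace induced by `τ`. -/
noncomputable def moment (τ : G → ℝ) (A : Matrix (Fin d) (Fin d) (MonoidAlgebra ℤ G))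
    (K k : ℕ) : ℝ :=
  traceOf τ (((K : Matrix (Fin d) (Fin d) (MonoidAlgebra ℤ G)) - adjointMatrix A * A) ^ k) /
    (K : ℝ) ^ k

/-- An action on `n` points turns `A*A` into an integer matrix `NᵀN` whose row sums are bounded by
the `ℓ¹`-norm, whatever `n` and the action are. -/
theorem exists_forall_abs_moment_sub_le (A : Matrix (Fin d) (Fin d) (MonoidAlgebra ℤ G)) {K : ℕ}
    (hK : 1 < K) (hAK : matrixLOneNorm (adjointMatrix A * A) ≤ K) {η : ℝ} (hη : 0 < η) :
    ∃ k₀ : ℕ, ∀ k k' : ℕ, k₀ ≤ k → k₀ ≤ k' → ∀ (n : ℕ), 0 < n → ∀ ψ : G →* Equiv.Perm (Fin n),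
      |moment (fun g => (numFix (ψ g) : ℝ) / n) A K k -
        moment (fun g => (numFix (ψ g) : ℝ) / n) A K k'| ≤ η := by
  -- The matrices have size `d * n` but traces are divided by `n` only; `d + 1` instead of `d`
  -- covers `d = 0`.
  have hη' : 0 < η / (d + 1) := by positivity
  obtain ⟨k₀, h⟩ := exists_forall_abs_trace_pow_sub_le (K := K) (by exact_mod_cast hK) hη'
  refine ⟨k₀, fun k k' hk hk' n hn ψ => ?_⟩
  have hn' : (0 : ℝ) < n := by exact_mod_cast hn
  set M := permMatrixHom d ψ (adjointMatrix A * A) with hM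
  set N := (permMatrixHom d ψ A).map (Int.castRingHom ℝ) with hN
  have hMN : M.map (Int.castRingHom ℝ) = N.conjTranspose * N := by
    rw [hM, map_mul, permMatrixHom_adjointMatrix, Matrix.map_mul, hN]
    congr 1
  have hpos : (M.map (Int.castRingHom ℝ)).PosSemidef := by
    rw [hMN]; exact Matrix.posSemidef_conjTranspose_mul_self N
  have hrow : ∀ p, ∑ q, |(M p q : ℝ)| ≤ K := fun p => (row_sum_permMatrixHom_le ψ _ p).trans hAK
  have hmom : ∀ k, moment (fun g => (numFix (ψ g) : ℝ) / n) A K k =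
      (((K : ℝ) • (1 : Matrix (Fin d × Fin n) (Fin d × Fin n) ℝ) -
        M.map (Int.castRingHom ℝ)) ^ k).trace / (K : ℝ) ^ k / n := by
    intro k
    rw [moment, traceOf_div, ← trace_permMatrixHom, div_right_comm, map_pow, map_sub, map_natCast,
      ← hM]
    congr 2
    have h1 : ((K : ℝ) • (1 : Matrix (Fin d × Fin n) (Fin d × Fin n) ℝ) -
        M.map (Int.castRingHom ℝ)) =
        (Int.castRingHom ℝ).mapMatrix ((K : Matrix (Fin d × Fin n) (Fin d × Fin n) ℤ) - M) := by
      rw [map_sub, map_natCast, RingHom.mapMatrix_apply]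
      congr 1
      rw [Nat.cast_smul_eq_nsmul, nsmul_one]
    rw [h1, ← map_pow, RingHom.mapMatrix_apply, Matrix.trace, Matrix.trace, Int.cast_sum]
    rfl
  rw [hmom, hmom, ← sub_div, abs_div, abs_of_pos hn', div_le_iff₀ hn']
  refine (h k k' hk hk' _ M hpos hrow).trans ?_
  rw [Fintype.card_prod, Fintype.card_fin, Fintype.card_fin, Nat.cast_mul, ← mul_assoc]
  refine mul_le_mul_of_nonneg_right ?_ hn'.le
  rw [div_mul_eq_mul_div, div_le_iff₀ (by positivity)]
  nlinarith

end Permutation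

/-! ### Sofic approximations by actions of a free group -/

section Sofic

variable {n : ℕ}

theorem hammingDist_mul_left (ρ σ τ : Equiv.Perm (Fin n)) :
    hammingDist (⇑(ρ * σ)) (⇑(ρ * τ)) = hammingDist (⇑σ) (⇑τ) :=
  hammingDist_comp (fun _ => ρ) (fun _ => ρ.injective)

theorem hammingDist_mul_right (ρ σ τ : Equiv.Perm (Fin n)) :
    hammingDist (⇑(σ * ρ)) (⇑(τ * ρ)) = hammingDist (⇑σ) (⇑τ) := by
  unfold hammingDist
  refine Finset.card_bij (fun x _ => ρ x) (fun x hx => ?_) (fun x _ y _ h => ρ.injective h)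
    fun y hy => ⟨ρ⁻¹ y, ?_, by simp⟩
  · exact Finset.mem_filter.2 ⟨Finset.mem_univ _, (Finset.mem_filter.1 hx).2⟩
  · refine Finset.mem_filter.2 ⟨Finset.mem_univ _, ?_⟩
    simpa using (Finset.mem_filter.1 hy).2

theorem numFix_add_hammingDist (σ : Equiv.Perm (Fin n)) :
    numFix σ + hammingDist (⇑σ) (⇑(1 : Equiv.Perm (Fin n))) = n := by
  have h : numFix σ = (Finset.univ.filter fun x => σ x = x).card := by
    rw [numFix, ← Set.ncard_coe_finset]
    congr 1
    ext x
    simp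
  rw [h, hammingDist]
  convert Finset.card_filter_add_card_filter_not (s := (Finset.univ : Finset (Fin n)))
    (fun x => σ x = x)
  all_goals simp

theorem hammingDist_le_of_le_numFix {σ τ : Equiv.Perm (Fin n)} {ε : ℝ}
    (h : (1 - ε) * n ≤ numFix (σ * τ⁻¹)) : (hammingDist (⇑σ) (⇑τ) : ℝ) ≤ ε * n := by
  have h1 := numFix_add_hammingDist (σ * τ⁻¹)
  rw [← hammingDist_mul_right τ, inv_mul_cancel_right, one_mul] at h1
  have h2 : (numFix (σ * τ⁻¹) : ℝ) + hammingDist (⇑σ) (⇑τ) = n := by exact_mod_cast h1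
  linarith

theorem numFix_le_add_hammingDist (σ τ : Equiv.Perm (Fin n)) :
    numFix σ ≤ numFix τ + hammingDist (⇑σ) (⇑τ) := by
  have h1 := numFix_add_hammingDist σ
  have h2 := numFix_add_hammingDist τ
  have h3 := hammingDist_triangle (⇑τ) (⇑σ) (⇑(1 : Equiv.Perm (Fin n)))
  rw [hammingDist_comm (⇑τ) (⇑σ)] at h3
  omega

variable {G : Type*} [Group G]

/-- The map `φ` is multiplicative on `F` up to an error of proportion `ε`. -/
def IsAlmostHomOn (F : Finset G) (ε : ℝ) (φ : G → Equiv.Perm (Fin n)) : Prop :=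
  φ 1 = 1 ∧ ∀ e ∈ F, ∀ f ∈ F, (hammingDist (⇑(φ e * φ f)) (⇑(φ (e * f))) : ℝ) ≤ ε * n

theorem IsAlmostHomOn.mono {F F' : Finset G} {ε : ℝ} {φ : G → Equiv.Perm (Fin n)}
    (h : IsAlmostHomOn F' ε φ) (hF : F ⊆ F') : IsAlmostHomOn F ε φ :=
  ⟨h.1, fun e he f hf => h.2 e (hF he) f (hF hf)⟩

/-- The action of the free group obtained by prescribing the action of the generators. -/
def inducedAction {m : ℕ} (π : FreeGroup (Fin m) →* G) (φ : G → Equiv.Perm (Fin n)) :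
    FreeGroup (Fin m) →* Equiv.Perm (Fin n) :=
  FreeGroup.lift fun i => φ (π (FreeGroup.of i))

/-- Each multiplication in `w` costs one use of almost multiplicativity, and errors add since the
Hamming distance is bi-invariant. The point is that `C` and `F` depend on the word alone, not on
`n`, `ε` or `φ`. -/
theorem exists_hammingDist_inducedAction_le {m : ℕ} (π : FreeGroup (Fin m) →* G)
    (w : FreeGroup (Fin m)) :
    ∃ (C : ℕ) (F : Finset G), ∀ (n : ℕ) (ε : ℝ) (φ : G → Equiv.Perm (Fin n)),
      IsAlmostHomOn F ε φ →
        (hammingDist (⇑(inducedAction π φ w)) (⇑(φ (π w))) : ℝ) ≤ C * (ε * n) := by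
  classical
  induction w using FreeGroup.induction_on with
  | C1 =>
    refine ⟨0, ∅, fun n ε φ h => ?_⟩
    rw [map_one, map_one, h.1, hammingDist_self]
    simp
  | of i =>
    refine ⟨0, ∅, fun n ε φ h => ?_⟩
    rw [inducedAction, FreeGroup.lift_apply_of, hammingDist_self]
    simp
  | inv_of i _ =>
    set g := π (FreeGroup.of i) with hg
    refine ⟨1, {g, g⁻¹}, fun n ε φ h => ?_⟩
    have h1 := h.2 g (by simp) g⁻¹ (by simp)
    rw [mul_inv_cancel, h.1] at h1
    rw [map_inv, map_inv, inducedAction, FreeGroup.lift_apply_of, ← hg,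
      ← hammingDist_mul_left (φ g), mul_inv_cancel, hammingDist_comm, Nat.cast_one, one_mul]
    exact h1
  | mul x y hx hy =>
    obtain ⟨C₁, F₁, h₁⟩ := hx
    obtain ⟨C₂, F₂, h₂⟩ := hy
    refine ⟨C₁ + C₂ + 1, F₁ ∪ F₂ ∪ {π x, π y}, fun n ε φ h => ?_⟩
    have a1 := h₁ n ε φ (h.mono fun z hz => by simp [hz])
    have a2 := h₂ n ε φ (h.mono fun z hz => by simp [hz])
    have a3 := h.2 (π x) (by simp) (π y) (by simp)
    rw [map_mul, map_mul]
    rw [← hammingDist_mul_right (inducedAction π φ y)] at a1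
    rw [← hammingDist_mul_left (φ (π x))] at a2
    have t1 := hammingDist_triangle (⇑(inducedAction π φ x * inducedAction π φ y))
      (⇑(φ (π x) * inducedAction π φ y)) (⇑(φ (π x * π y)))
    have t2 := hammingDist_triangle (⇑(φ (π x) * inducedAction π φ y))
      (⇑(φ (π x) * φ (π y))) (⇑(φ (π x * π y)))
    have t := (Nat.cast_le (α := ℝ)).2 (t1.trans (Nat.add_le_add_left t2 _))
    rw [Nat.cast_add, Nat.cast_add] at t
    rw [Nat.cast_add, Nat.cast_add, Nat.cast_one]
    linarith

open Classical in
/-- The positive definite function on a group attached to the kernel of a homomorphism. -/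
noncomputable def kerIndicator {F : Type*} [Group F] (π : F →* G) (w : F) : ℝ :=
  if π w = 1 then 1 else 0

/-- The fixed point proportions of actions of a free group on finite sets approximate the
indicator function of the kernel of a homomorphism to a sofic group. -/
theorem IsSofic.exists_action (hG : IsSofic G) {m : ℕ} (π : FreeGroup (Fin m) →* G)
    (W : Finset (FreeGroup (Fin m))) {δ : ℝ} (hδ : 0 < δ) :
    ∃ n : ℕ, 0 < n ∧ ∃ ψ : FreeGroup (Fin m) →* Equiv.Perm (Fin n),
      ∀ w ∈ W, |(numFix (ψ w) : ℝ) / n - kerIndicator π w| ≤ δ := by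
  classical
  choose C F hCF using exists_hammingDist_inducedAction_le π
  set c : ℕ := ∑ w ∈ W, C w with hc
  -- The induced action differs from `φ` by at most `c * ε`, and freeness of `φ` costs a further
  -- `ε`; `1 / 2` keeps `ε < 1`.
  have hε : 0 < min (1 / 2) (δ / (c + 1)) := lt_min (by norm_num) (by positivity)
  have hε1 : min (1 / 2) (δ / (c + 1)) < 1 := (min_le_left _ _).trans_lt (by norm_num)
  have hεδ : (c + 1) * min (1 / 2) (δ / (c + 1)) ≤ δ := by
    have := min_le_right (1 / 2) (δ / (c + 1))
    rwa [le_div_iff₀' (by positivity)] at this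
  set ε := min (1 / 2) (δ / (c + 1))
  obtain ⟨n, hn, φ, hmul, hone, hfree⟩ := hG ε hε hε1 (W.biUnion F ∪ W.image π)
  have hn' : (0 : ℝ) < n := by exact_mod_cast hn
  refine ⟨n, hn, inducedAction π φ, fun w hw => ?_⟩
  have hd : (hammingDist (⇑(inducedAction π φ w)) (⇑(φ (π w))) : ℝ) ≤ c * (ε * n) := by
    refine (hCF w n ε φ ⟨hone, fun e he f hf => hammingDist_le_of_le_numFix
      (hmul e ?_ f ?_)⟩).trans ?_
    · exact Finset.mem_union_left _ (Finset.mem_biUnion.2 ⟨w, hw, he⟩)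
    · exact Finset.mem_union_left _ (Finset.mem_biUnion.2 ⟨w, hw, hf⟩)
    · have : (C w : ℝ) ≤ c := by
        exact_mod_cast Finset.single_le_sum (f := C) (fun _ _ => Nat.zero_le _) hw
      exact mul_le_mul_of_nonneg_right this (by positivity)
  have hεn : (c + 1) * (ε * n) ≤ δ * n := by
    rw [← mul_assoc]; exact mul_le_mul_of_nonneg_right hεδ hn'.le
  have hεn0 : 0 < ε * n := by positivity
  unfold kerIndicator
  split_ifs with h
  · rw [h, hone] at hd
    have h1 := numFix_add_hammingDist (inducedAction π φ w)
    have h2 : (numFix (inducedAction π φ w) : ℝ) +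
      hammingDist (⇑(inducedAction π φ w)) (⇑(1 : Equiv.Perm (Fin n))) = n := by exact_mod_cast h1
    rw [div_sub_one hn'.ne', abs_div, abs_of_pos hn', div_le_iff₀ hn', abs_le]
    have h3 : (0 : ℝ) ≤ hammingDist (⇑(inducedAction π φ w)) (⇑(1 : Equiv.Perm (Fin n))) :=
      Nat.cast_nonneg _
    constructor <;> nlinarith
  · have h1 : (numFix (inducedAction π φ w) : ℝ) ≤
        numFix (φ (π w)) + hammingDist (⇑(inducedAction π φ w)) (⇑(φ (π w))) := by
      exact_mod_cast numFix_le_add_hammingDist _ _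
    have h2 := hfree (π w) (Finset.mem_union_right _ (Finset.mem_image_of_mem _ hw)) h
    rw [sub_zero, abs_of_nonneg (by positivity), div_le_iff₀ hn']
    linarith

/-- In a sofic group the moments converge at a rate that depends on the matrix only. -/
theorem exists_forall_abs_moment_kerIndicator_sub_le {m d : ℕ}
    (A : Matrix (Fin d) (Fin d) (MonoidAlgebra ℤ (FreeGroup (Fin m)))) {K : ℕ}
    (hK : 1 < K) (hAK : matrixLOneNorm (adjointMatrix A * A) ≤ K) {η : ℝ} (hη : 0 < η) :
    ∃ k₀ : ℕ, ∀ k k' : ℕ, k₀ ≤ k → k₀ ≤ k' → ∀ (G : Type*) [Group G], IsSofic G →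
      ∀ π : FreeGroup (Fin m) →* G,
        |moment (kerIndicator π) A K k - moment (kerIndicator π) A K k'| ≤ η := by
  classical
  obtain ⟨k₀, h⟩ := exists_forall_abs_moment_sub_le A hK hAK hη
  refine ⟨k₀, fun k k' hk hk' G _ hG π => le_of_forall_pos_le_add fun θ hθ => ?_⟩
  set X : ℕ → Matrix (Fin d) (Fin d) (MonoidAlgebra ℤ (FreeGroup (Fin m))) := fun k =>
    ((K : Matrix (Fin d) (Fin d) (MonoidAlgebra ℤ (FreeGroup (Fin m)))) - adjointMatrix A * A) ^ k
  set W : ℕ → Finset (FreeGroup (Fin m)) := fun k =>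
    Finset.univ.biUnion fun i => (X k i i).coeff.support
  set L : ℕ → ℝ := fun k => ∑ i, lOneNorm (X k i i)
  have hL : ∀ k, 0 ≤ L k := fun k => Finset.sum_nonneg fun _ _ => lOneNorm_nonneg _
  have hLk := hL k
  have hLk' := hL k'
  -- The finite action may depend on `k`, `k'` and `θ`, because `k₀` is already fixed and serves all
  -- actions; the approximation errors of the two moments together are at most `θ`.
  have hδ : 0 < θ / (L k + L k' + 1) := by positivity
  obtain ⟨n, hn, ψ, hψ⟩ := hG.exists_action π (W k ∪ W k') hδ
  set δ := θ / (L k + L k' + 1)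
  have hK1 : (1 : ℝ) ≤ K := by exact_mod_cast hK.le
  have happ : ∀ l, (∀ w ∈ W l, |(numFix (ψ w) : ℝ) / n - kerIndicator π w| ≤ δ) →
      |moment (fun g => (numFix (ψ g) : ℝ) / n) A K l - moment (kerIndicator π) A K l| ≤
        δ * L l := by
    intro l hl
    rw [moment, moment, ← sub_div, abs_div, abs_of_pos (by positivity : (0 : ℝ) < (K : ℝ) ^ l)]
    refine (div_le_self (abs_nonneg _) (one_le_pow₀ hK1)).trans ?_
    exact abs_traceOf_sub_le fun i g hg =>
      hl g (Finset.mem_biUnion.2 ⟨i, Finset.mem_univ _, hg⟩)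
  have h1 := happ k fun w hw => hψ w (Finset.mem_union_left _ hw)
  have h2 := happ k' fun w hw => hψ w (Finset.mem_union_right _ hw)
  have h3 := h k k' hk hk' n hn ψ
  have h4 : δ * (L k + L k') ≤ θ := by
    rw [div_mul_eq_mul_div, div_le_iff₀ (by positivity)]
    nlinarith
  rw [abs_le] at *
  constructor <;> nlinarith

/-! ### Powers of contractions and projections onto kernels -/

section Hilbert

open Filter ContinuousLinearMap

variable {H : Type*} [NormedAddCommGroup H] [InnerProductSpace ℂ H] [CompleteSpace H]

theorem norm_one_sub_smul_adjoint_comp_self_le (A : H →L[ℂ] H) {K : ℝ} (hK : 0 < K)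
    (hA : ‖A‖ ^ 2 ≤ K) : ‖(1 : H →L[ℂ] H) - ((K⁻¹ : ℝ) : ℂ) • (adjoint A * A)‖ ≤ 1 := by
  refine opNorm_le_bound _ zero_le_one fun v => ?_
  rw [one_mul]
  -- In the expanded square, the cross term `-2 K⁻¹ ‖A v‖²` absorbs the last term, which is at most
  -- `K⁻¹ ‖A v‖²`.
  refine le_of_sq_le_sq ?_ (norm_nonneg _)
  have h1 : RCLike.re ⟪v, ((K⁻¹ : ℝ) : ℂ) • adjoint A (A v)⟫_ℂ = K⁻¹ * ‖A v‖ ^ 2 := by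
    rw [inner_smul_right, adjoint_inner_right, inner_self_eq_norm_sq_to_K, RCLike.re_eq_complex_re,
      Complex.re_ofReal_mul]
    congr 1
    norm_cast
  have h2 : ‖((K⁻¹ : ℝ) : ℂ) • adjoint A (A v)‖ ^ 2 ≤ K⁻¹ * ‖A v‖ ^ 2 := by
    rw [norm_smul, mul_pow, Complex.norm_real, Real.norm_of_nonneg (by positivity)]
    have h3 : ‖adjoint A (A v)‖ ^ 2 ≤ K * ‖A v‖ ^ 2 := by
      have h4 := (adjoint A).le_opNorm (A v)
      rw [LinearIsometryEquiv.norm_map] at h4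
      calc _ ≤ (‖A‖ * ‖A v‖) ^ 2 := pow_le_pow_left₀ (norm_nonneg _) h4 2
        _ = ‖A‖ ^ 2 * ‖A v‖ ^ 2 := mul_pow _ _ _
        _ ≤ _ := mul_le_mul_of_nonneg_right hA (by positivity)
    calc K⁻¹ ^ 2 * ‖adjoint A (A v)‖ ^ 2 ≤ K⁻¹ ^ 2 * (K * ‖A v‖ ^ 2) :=
          mul_le_mul_of_nonneg_left h3 (by positivity)
      _ = K⁻¹ * ‖A v‖ ^ 2 := by field_simp
  have h5 : 0 ≤ K⁻¹ * ‖A v‖ ^ 2 := by positivity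
  have h6 : ((1 : H →L[ℂ] H) - ((K⁻¹ : ℝ) : ℂ) • (adjoint A * A)) v =
      v - ((K⁻¹ : ℝ) : ℂ) • adjoint A (A v) := rfl
  rw [h6, norm_sub_sq (𝕜 := ℂ), h1]
  linarith

theorem starProjection_congr {U V : Submodule ℂ H} [U.HasOrthogonalProjection]
    [V.HasOrthogonalProjection] (h : U = V) : U.starProjection = V.starProjection := by
  subst h
  rfl

/-- Von Neumann's mean ergodic theorem for the contraction `1 - K⁻¹ A*A`, whose fixed vectors form
`ker A*A = ker A`. Averaging avoids the spectral theorem. -/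
theorem tendsto_average_pow_apply (A : H →L[ℂ] H) [(A.ker).HasOrthogonalProjection]
    {K : ℝ} (hK : 0 < K) (hA : ‖A‖ ^ 2 ≤ K) (v : H) :
    Tendsto (fun N : ℕ => (N : ℂ)⁻¹ • ∑ k ∈ Finset.range N,
      (((1 : H →L[ℂ] H) - ((K⁻¹ : ℝ) : ℂ) • (adjoint A * A)) ^ k) v) atTop
      (𝓝 ((A.ker).starProjection v)) := by
  set S := (1 : H →L[ℂ] H) - ((K⁻¹ : ℝ) : ℂ) • (adjoint A * A) with hS
  have h := S.tendsto_birkhoffAverage_orthogonalProjection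
    (norm_one_sub_smul_adjoint_comp_self_le A hK hA) v
  have hker : (S.eqLocus (1 : H →L[ℂ] H)) = A.ker := by
    rw [← ker_adjoint_comp_self]
    ext x
    have hK' : ((K⁻¹ : ℝ) : ℂ) ≠ 0 := by exact_mod_cast (inv_pos.2 hK).ne'
    have hx : S x = x - ((K⁻¹ : ℝ) : ℂ) • (adjoint A ∘L A) x := rfl
    rw [LinearMap.mem_eqLocus, LinearMap.mem_ker]
    change S x = x ↔ (adjoint A ∘L A) x = 0
    rw [hx, sub_eq_self, smul_eq_zero, or_iff_right hK']
  rw [← Submodule.starProjection_apply, starProjection_congr hker] at h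
  refine h.congr fun N => ?_
  rw [birkhoffAverage, birkhoffSum]
  refine congrArg _ (Finset.sum_congr rfl fun k _ => ?_)
  rw [FunLike.coe_pow_eq_iterate, id]

end Hilbert

/-! ### Matrices over the group ring as operators -/

section Operators

variable {F G : Type*} [Group F] [Group G] {d : ℕ}

theorem inner_leftRegular_inv (g : G) (f h : EllTwo G) :
    ⟪leftRegular G g⁻¹ f, h⟫_ℂ = ⟪f, leftRegular G g h⟫_ℂ := by
  rw [lp.inner_eq_tsum, lp.inner_eq_tsum, ← (Equiv.mulLeft g⁻¹).tsum_eq]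
  refine tsum_congr fun x => ?_
  change ⟪f (g⁻¹⁻¹ * (g⁻¹ * x)), h (g⁻¹ * x)⟫_ℂ = ⟪f x, h (g⁻¹ * x)⟫_ℂ
  rw [inv_inv, mul_inv_cancel_left]

theorem norm_leftRegular_le (g : G) : ‖leftRegular G g‖ ≤ 1 :=
  LinearMap.mkContinuous_norm_le _ zero_le_one fun f => by
    rw [norm_translateLin, one_mul]

theorem groupRingRep_single (g : G) (c : ℤ) :
    groupRingRep G (MonoidAlgebra.single g c) = (c : ℂ) • leftRegular G g := by
  rw [groupRingRep, MonoidAlgebra.lift_single, Int.cast_smul_eq_zsmul]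

theorem inner_groupRingRep_mapDomain_inv (x : MonoidAlgebra ℤ G) (f h : EllTwo G) :
    ⟪groupRingRep G (MonoidAlgebra.mapDomain (fun g => g⁻¹) x) f, h⟫_ℂ =
      ⟪f, groupRingRep G x h⟫_ℂ := by
  induction x using MonoidAlgebra.induction_linear with
  | zero => simp
  | add x y hx hy =>
    rw [MonoidAlgebra.mapDomain_add, map_add, map_add, add_apply,
      add_apply, inner_add_left, inner_add_right, hx, hy]
  | single g c =>
    rw [MonoidAlgebra.mapDomain_single, groupRingRep_single, groupRingRep_single,
      smul_apply, smul_apply, inner_smul_left,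
      inner_smul_right, inner_leftRegular_inv, map_intCast]

theorem norm_groupRingRep_mapDomain_le (π : F →* G) (x : MonoidAlgebra ℤ F) :
    ‖groupRingRep G (MonoidAlgebra.mapDomainRingHom ℤ π x)‖ ≤ lOneNorm x := by
  conv_lhs => rw [← MonoidAlgebra.sum_coeff_single x]
  rw [Finsupp.sum, map_sum, map_sum, lOneNorm]
  refine (norm_sum_le _ _).trans (Finset.sum_le_sum fun g _ => ?_)
  rw [MonoidAlgebra.mapDomainRingHom_apply, MonoidAlgebra.mapDomain_single, groupRingRep_single,
    norm_smul, Complex.norm_intCast]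
  exact mul_le_of_le_one_right (abs_nonneg _) (norm_leftRegular_le _)

theorem matrixOp_apply (A : Matrix (Fin d) (Fin d) (MonoidAlgebra ℤ G)) (f : EllTwoPow G d)
    (i : Fin d) : matrixOp A f i = ∑ j, groupRingRep G (A i j) (f j) := by
  simp [matrixOp]

/-- The action of matrices over the group ring, as a ring homomorphism. -/
noncomputable def matrixOpHom (G : Type*) [Group G] (d : ℕ) :
    Matrix (Fin d) (Fin d) (MonoidAlgebra ℤ G) →+* (EllTwoPow G d →L[ℂ] EllTwoPow G d) where
  toFun := matrixOp
  map_one' := by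
    ext1 f; ext1 i
    rw [matrixOp_apply, Finset.sum_eq_single i] <;> simp +contextual [eq_comm]
  map_mul' A B := by
    ext1 f; ext1 i
    simp only [matrixOp_apply, Matrix.mul_apply, map_sum, map_mul, sum_apply,
      mul_apply_eq_comp]
    rw [Finset.sum_comm]
  map_zero' := by
    ext1 f; ext1 i
    simp [matrixOp_apply]
  map_add' A B := by
    ext1 f; ext1 i
    simp [matrixOp_apply, Finset.sum_add_distrib]

theorem matrixOpHom_apply (A : Matrix (Fin d) (Fin d) (MonoidAlgebra ℤ G)) :
    matrixOpHom G d A = matrixOp A := rfl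

theorem matrixOp_adjointMatrix (A : Matrix (Fin d) (Fin d) (MonoidAlgebra ℤ G)) :
    matrixOp (adjointMatrix A) = ContinuousLinearMap.adjoint (matrixOp A) := by
  rw [ContinuousLinearMap.eq_adjoint_iff]
  intro f h
  simp only [PiLp.inner_apply, matrixOp_apply, sum_inner, inner_sum, adjointMatrix,
    Matrix.of_apply, inner_groupRingRep_mapDomain_inv]
  exact Finset.sum_comm

/-- The bound is taken before applying `π`, so that one `K` serves all the groups. -/
theorem norm_matrixOp_map_le (π : F →* G) (A : Matrix (Fin d) (Fin d) (MonoidAlgebra ℤ F)) :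
    ‖matrixOp (A.map (MonoidAlgebra.mapDomainRingHom ℤ π))‖ ≤ matrixLOneNorm A := by
  refine ContinuousLinearMap.opNorm_le_bound _ (matrixLOneNorm_nonneg A) fun f => ?_
  set h := matrixOp (A.map (MonoidAlgebra.mapDomainRingHom ℤ π)) f with hh
  have hsum : h = ∑ i, PiLp.single 2 i (h i) := by
    ext1 j
    simp [Finset.sum_apply, PiLp.ofLp_single]
  rw [hsum, matrixLOneNorm, Finset.sum_mul]
  refine (norm_sum_le _ _).trans (Finset.sum_le_sum fun i _ => ?_)
  rw [PiLp.norm_single, hh, matrixOp_apply, Finset.sum_mul]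
  refine (norm_sum_le _ _).trans (Finset.sum_le_sum fun j _ => ?_)
  refine (ContinuousLinearMap.le_opNorm _ _).trans ?_
  exact mul_le_mul (norm_groupRingRep_mapDomain_le π _) (PiLp.norm_apply_le f j) (norm_nonneg _)
    (lOneNorm_nonneg _)

theorem inner_unitVec_left (i : Fin d) (f : EllTwoPow G d) :
    ⟪unitVec i, f⟫_ℂ = (f i : G → ℂ) 1 := by
  classical
  rw [PiLp.inner_apply, Finset.sum_eq_single i]
  · rw [unitVec, PiLp.single_eq_same]
    convert lp.inner_single_left (𝕜 := ℂ) (1 : G) (1 : ℂ) (f i)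
    simp
  · intro j _ hj
    rw [unitVec, PiLp.single_eq_of_ne 2 hj, inner_zero_left]
  · simp

/-- The identity coefficient of the image of `x` collects the coefficients of `x` on the kernel of
`π`. So traces over all the groups become functionals on one group ring. -/
theorem groupRingRep_mapDomain_single_one (π : F →* G) (x : MonoidAlgebra ℤ F) [DecidableEq G] :
    (groupRingRep G (MonoidAlgebra.mapDomainRingHom ℤ π x)
      (lp.single 2 (1 : G) (1 : ℂ)) : G → ℂ) 1 =
      ((MonoidAlgebra.liftNC (Int.castAddHom ℝ) (kerIndicator π) x : ℝ) : ℂ) := by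
  induction x using MonoidAlgebra.induction_linear with
  | zero => simp
  | add x y hx hy =>
    rw [map_add, map_add, add_apply, lp.coeFn_add, Pi.add_apply, hx, hy,
      map_add, Complex.ofReal_add]
  | single w c =>
    rw [MonoidAlgebra.mapDomainRingHom_apply, MonoidAlgebra.mapDomain_single, groupRingRep_single,
      smul_apply, lp.coeFn_smul, Pi.smul_apply, MonoidAlgebra.liftNC_single]
    have h : (leftRegular G (π w) (lp.single 2 (1 : G) (1 : ℂ)) : G → ℂ) 1 =
        ((kerIndicator π w : ℝ) : ℂ) := by
      change (lp.single 2 (1 : G) (1 : ℂ) : EllTwo G) ((π w)⁻¹ * 1) = _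
      rw [mul_one, lp.single_apply, Pi.single_apply, kerIndicator]
      simp only [inv_eq_one]
      split_ifs <;> simp
    rw [h]
    simp

theorem vnTrace_matrixOp_map (π : F →* G) (A : Matrix (Fin d) (Fin d) (MonoidAlgebra ℤ F)) :
    vnTrace (matrixOp (A.map (MonoidAlgebra.mapDomainRingHom ℤ π))) =
      ((traceOf (kerIndicator π) A : ℝ) : ℂ) := by
  classical
  rw [vnTrace, traceOf, Complex.ofReal_sum]
  refine Finset.sum_congr rfl fun i _ => ?_
  rw [inner_unitVec_left, matrixOp_apply, Finset.sum_eq_single i]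
  · rw [unitVec, PiLp.single_eq_same, Matrix.map_apply]
    exact groupRingRep_mapDomain_single_one π (A i i)
  · intro j _ hj
    rw [unitVec, PiLp.single_eq_of_ne 2 hj, map_zero]
  · simp

open Filter in
theorem tendsto_average_moment (π : F →* G) (A : Matrix (Fin d) (Fin d) (MonoidAlgebra ℤ F))
    {K : ℕ} (hK : 0 < K) (hAK : matrixLOneNorm A ^ 2 ≤ K) :
    Tendsto (fun N : ℕ => (N : ℝ)⁻¹ * ∑ k ∈ Finset.range N, moment (kerIndicator π) A K k) atTop
      (𝓝 (vnDimKer (A.map (MonoidAlgebra.mapDomainRingHom ℤ π)))) := by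
  set B := A.map (MonoidAlgebra.mapDomainRingHom ℤ π) with hB
  set T := matrixOp B with hT
  have hK' : (0 : ℝ) < K := by exact_mod_cast hK
  have hTK : ‖T‖ ^ 2 ≤ (K : ℝ) :=
    (pow_le_pow_left₀ (norm_nonneg _) (norm_matrixOp_map_le π A) 2).trans hAK
  have : CompleteSpace T.ker := T.isClosed_ker.completeSpace_coe
  set S := (1 : EllTwoPow G d →L[ℂ] EllTwoPow G d) -
    (((K : ℝ)⁻¹ : ℝ) : ℂ) • (ContinuousLinearMap.adjoint T * T) with hS
  have hpow : ∀ k, vnTrace (S ^ k) = ((moment (kerIndicator π) A K k : ℝ) : ℂ) := by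
    intro k
    have h1 : S = (((K : ℝ)⁻¹ : ℝ) : ℂ) • matrixOpHom G d
        ((K : Matrix (Fin d) (Fin d) (MonoidAlgebra ℤ G)) - adjointMatrix B * B) := by
      rw [map_sub, map_natCast, map_mul, matrixOpHom_apply, matrixOpHom_apply,
        matrixOp_adjointMatrix, smul_sub, hS]
      congr 1
      have : ((K : ℕ) : EllTwoPow G d →L[ℂ] EllTwoPow G d) = (K : ℂ) • 1 :=
        (nsmul_one K).symm.trans (Nat.cast_smul_eq_nsmul ℂ K _).symm
      rw [this, smul_smul, Complex.ofReal_inv, Complex.ofReal_natCast, inv_mul_cancel₀, one_smul]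
      exact_mod_cast hK.ne'
    have h2 : (((K : Matrix (Fin d) (Fin d) (MonoidAlgebra ℤ G)) - adjointMatrix B * B) ^ k) =
        (((K : Matrix (Fin d) (Fin d) (MonoidAlgebra ℤ F)) - adjointMatrix A * A) ^ k).map
          (MonoidAlgebra.mapDomainRingHom ℤ π) := by
      rw [← RingHom.mapMatrix_apply, map_pow, map_sub, map_mul, map_natCast, hB, adjointMatrix_map]
      rfl
    rw [h1, smul_pow, ← map_pow, h2, matrixOpHom_apply, moment, Complex.ofReal_div,
      ← vnTrace_matrixOp_map π]
    simp only [vnTrace, smul_apply, inner_smul_right, ← Finset.mul_sum]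
    rw [div_eq_inv_mul]
    push_cast
    rw [inv_pow]
  have hlim : Tendsto (fun N : ℕ => ((N : ℂ)⁻¹ * ∑ k ∈ Finset.range N, vnTrace (S ^ k))) atTop
      (𝓝 (vnTrace (kerProj T))) := by
    have h : ∀ N : ℕ, ((N : ℂ)⁻¹ * ∑ k ∈ Finset.range N, vnTrace (S ^ k)) =
        ∑ i : Fin d, ⟪unitVec i, (N : ℂ)⁻¹ • ∑ k ∈ Finset.range N, (S ^ k) (unitVec i)⟫_ℂ := by
      intro N
      simp only [vnTrace, inner_smul_right, inner_sum, ← Finset.mul_sum]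
      rw [Finset.sum_comm]
    simp only [h]
    refine tendsto_finsetSum _ fun i _ => ?_
    exact tendsto_const_nhds.inner (tendsto_average_pow_apply T hK' hTK (unitVec i))
  refine ((Complex.continuous_re.tendsto _).comp hlim).congr fun N => ?_
  rw [Function.comp_apply, ← Complex.ofReal_re (_ * _)]
  congr 1
  push_cast
  rw [Finset.sum_congr rfl fun k _ => hpow k]

theorem vnDimKer_adjointMatrix_mul_self (A : Matrix (Fin d) (Fin d) (MonoidAlgebra ℤ G)) :
    vnDimKer (adjointMatrix A * A) = vnDimKer A := by
  have h : matrixOp (adjointMatrix A * A) =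
      ContinuousLinearMap.adjoint (matrixOp A) ∘L matrixOp A := by
    rw [← matrixOp_adjointMatrix]
    exact map_mul (matrixOpHom G d) _ _
  have h1 : CompleteSpace (LinearMap.ker (matrixOp A).toLinearMap) :=
    (matrixOp A).isClosed_ker.completeSpace_coe
  have h2 : CompleteSpace (LinearMap.ker (matrixOp (adjointMatrix A * A)).toLinearMap) :=
    (matrixOp (adjointMatrix A * A)).isClosed_ker.completeSpace_coe
  rw [vnDimKer, vnDimKer, kerProj, kerProj]
  congr 2
  apply starProjection_congr
  rw [h, ContinuousLinearMap.ker_adjoint_comp_self]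

/-- The Atiyah Conjecture implies integrality for all matrices over the group ring. -/
theorem AtiyahConjecture.exists_vnDimKer_eq (hG : AtiyahConjecture G) (htf : GroupTorsionFree G)
    (A : Matrix (Fin d) (Fin d) (MonoidAlgebra ℤ G)) : ∃ k : ℤ, vnDimKer A = k := by
  have h : matrixOp (adjointMatrix A * A) =
      ContinuousLinearMap.adjoint (matrixOp A) ∘L matrixOp A := by
    rw [← matrixOp_adjointMatrix]
    exact map_mul (matrixOpHom G d) _ _
  have hpos : (matrixOp (adjointMatrix A * A)).IsPositive := by
    rw [h]
    exact ContinuousLinearMap.isPositive_adjoint_comp_self _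
  rw [← vnDimKer_adjointMatrix_mul_self]
  exact hG htf d _ hpos.isSelfAdjoint hpos

end Operators

/-! ### Convergence of marked groups -/

section Convergence

open Filter

/-- A Cauchy sequence has the same limit as its Cesàro averages, and the Cauchy rate bounds the
distance to it. -/
theorem abs_sub_le_of_tendsto_average {u : ℕ → ℝ} {k₀ : ℝ → ℕ} {D : ℝ}
    (hu : ∀ η, 0 < η → ∀ k k', k₀ η ≤ k → k₀ η ≤ k' → |u k - u k'| ≤ η)
    (hD : Tendsto (fun N : ℕ => (N : ℝ)⁻¹ * ∑ k ∈ Finset.range N, u k) atTop (𝓝 D))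
    {η : ℝ} (hη : 0 < η) {k : ℕ} (hk : k₀ η ≤ k) : |u k - D| ≤ η := by
  have hc : CauchySeq u := Metric.cauchySeq_iff.2 fun ε hε =>
    ⟨k₀ (ε / 2), fun a ha b hb => (hu (ε / 2) (half_pos hε) a b ha hb).trans_lt (half_lt_self hε)⟩
  obtain ⟨l, hl⟩ := cauchySeq_tendsto_of_complete hc
  rw [tendsto_nhds_unique hD hl.cesaro]
  exact le_of_tendsto (tendsto_const_nhds.sub hl).abs
    (eventually_atTop.2 ⟨k₀ η, fun k' hk' => hu η hη k k' hk hk'⟩)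

namespace MarkedGroup

variable {m d : ℕ}

theorem eval_surjective (G : MarkedGroup.{u} m) : Function.Surjective G.eval := by
  rw [← MonoidHom.range_eq_top, eval, FreeGroup.range_lift_eq_closure, G.closure_range_gen]

theorem exists_evalMatrix_eq (G : MarkedGroup.{u} m)
    (B : Matrix (Fin d) (Fin d) (MonoidAlgebra ℤ G.carrier)) : ∃ A, G.evalMatrix A = B := by
  have hs : Function.Surjective (MonoidAlgebra.mapDomainRingHom ℤ G.eval) := by
    intro x
    induction x using MonoidAlgebra.induction_linear with
    | zero => exact ⟨0, map_zero _⟩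
    | add x y hx hy =>
      obtain ⟨a, rfl⟩ := hx
      obtain ⟨b, rfl⟩ := hy
      exact ⟨a + b, map_add _ _ _⟩
    | single g c =>
      obtain ⟨w, rfl⟩ := G.eval_surjective g
      exact ⟨MonoidAlgebra.single w c, by simp⟩
  choose f hf using hs
  exact ⟨B.map f, by ext1 i j; simp [evalMatrix, hf]⟩

theorem eventually_eval_eq_one_iff {Γ : ℕ → MarkedGroup.{u} m} {Γlim : MarkedGroup.{u} m}
    (hlim : Tendsto Γ atTop (𝓝 Γlim)) (w : FreeGroup (Fin m)) :
    ∀ᶠ n in atTop, ((Γ n).eval w = 1 ↔ Γlim.eval w = 1) := by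
  filter_upwards [Metric.tendsto_nhds.1 hlim ((1 / 2) ^ w.norm) (by positivity)] with n hn
  by_contra h
  -- Distance below `2^(-|w|)` forces agreement up to length `|w| + 1`, one more than needed.
  exact not_le.2 hn (le_markedDist fun hs => h (hs w (Nat.le_succ _)))

theorem eventually_moment_eq {Γ : ℕ → MarkedGroup.{u} m} {Γlim : MarkedGroup.{u} m}
    (hlim : Tendsto Γ atTop (𝓝 Γlim))
    (A : Matrix (Fin d) (Fin d) (MonoidAlgebra ℤ (FreeGroup (Fin m)))) (K k : ℕ) :
    ∀ᶠ n in atTop, moment (kerIndicator (Γ n).eval) A K k =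
      moment (kerIndicator Γlim.eval) A K k := by
  set X := ((K : Matrix (Fin d) (Fin d) (MonoidAlgebra ℤ (FreeGroup (Fin m)))) -
    adjointMatrix A * A) ^ k
  have h : ∀ᶠ n in atTop, ∀ i, ∀ w ∈ (X i i).coeff.support,
      ((Γ n).eval w = 1 ↔ Γlim.eval w = 1) :=
    eventually_all.2 fun i => (Filter.eventually_all_finset _).2 fun w _ =>
      eventually_eval_eq_one_iff hlim w
  filter_upwards [h] with n hn
  rw [moment, moment]
  congr 1
  refine traceOf_congr fun i w hw => ?_
  have hw' := hn i w hw
  unfold kerIndicator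
  by_cases h1 : Γlim.eval w = 1
  · rw [if_pos h1, if_pos (hw'.2 h1)]
  · rw [if_neg h1, if_neg (mt hw'.1 h1)]

theorem tendsto_vnDimKer_evalMatrix {Γ : ℕ → MarkedGroup.{u} m} {Γlim : MarkedGroup.{u} m}
    (hlim : Tendsto Γ atTop (𝓝 Γlim)) (hsofic : ∀ n, IsSofic (Γ n).carrier)
    (A : Matrix (Fin d) (Fin d) (MonoidAlgebra ℤ (FreeGroup (Fin m)))) :
    Tendsto (fun n => vnDimKer ((Γ n).evalMatrix A)) atTop (𝓝 (vnDimKer (Γlim.evalMatrix A))) := by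
  -- The three bounds serve, in order, the base `K > 1` of the eigenvalue count, the row sums of the
  -- permutation models, and contractivity on `ℓ²`.
  obtain ⟨K, hK⟩ := exists_nat_ge (max 2 (max (matrixLOneNorm (adjointMatrix A * A))
    (matrixLOneNorm A ^ 2)))
  have hK2 : 2 ≤ K := by exact_mod_cast (le_max_left _ _).trans hK
  have hK1 : 1 < K := hK2
  have hAA := (le_max_left _ _).trans ((le_max_right _ _).trans hK)
  have hA := (le_max_right _ _).trans ((le_max_right _ _).trans hK)
  have hrate : ∀ η : ℝ, ∃ k₀ : ℕ, 0 < η → ∀ k k' : ℕ, k₀ ≤ k → k₀ ≤ k' → ∀ n,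
      |moment (kerIndicator (Γ n).eval) A K k - moment (kerIndicator (Γ n).eval) A K k'| ≤ η := by
    intro η
    by_cases hη : 0 < η
    · obtain ⟨k₀, h⟩ := exists_forall_abs_moment_kerIndicator_sub_le A hK1 hAA hη
      exact ⟨k₀, fun _ k k' hk hk' n => h k k' hk hk' _ (hsofic n) _⟩
    · exact ⟨0, fun h => absurd h hη⟩
  choose k₀ hk₀ using hrate
  have hratelim : ∀ η : ℝ, 0 < η → ∀ k k' : ℕ, k₀ η ≤ k → k₀ η ≤ k' →
      |moment (kerIndicator Γlim.eval) A K k - moment (kerIndicator Γlim.eval) A K k'| ≤ η := by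
    intro η hη k k' hk hk'
    -- A single `n` whose two moments agree with those of the limit transfers the rate, so soficity
    -- of the limit group is never needed.
    obtain ⟨n, hn, hn'⟩ :=
      ((eventually_moment_eq hlim A K k).and (eventually_moment_eq hlim A K k')).exists
    rw [← hn, ← hn']
    exact hk₀ η hη k k' hk hk' n
  refine Metric.tendsto_nhds.2 fun ε hε => ?_
  have hη : 0 < ε / 3 := by positivity
  -- At this one exponent the moments coincide and each is within `ε / 3` of its dimension, giving a
  -- total of `2ε / 3 < ε`.
  filter_upwards [eventually_moment_eq hlim A K (k₀ (ε / 3))] with n hn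
  have h1 := abs_sub_le_of_tendsto_average (fun η hη k k' hk hk' => hk₀ η hη k k' hk hk' n)
    (tendsto_average_moment (Γ n).eval A (zero_lt_one.trans hK1) hA) hη le_rfl
  have h2 := abs_sub_le_of_tendsto_average hratelim
    (tendsto_average_moment Γlim.eval A (zero_lt_one.trans hK1) hA) hη le_rfl
  rw [hn] at h1
  rw [abs_le] at h1 h2
  rw [Real.dist_eq, abs_lt, evalMatrix, evalMatrix]
  constructor <;> linarith

theorem groupTorsionFree_of_tendsto {Γ : ℕ → MarkedGroup.{u} m} {Γlim : MarkedGroup.{u} m}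
    (hlim : Tendsto Γ atTop (𝓝 Γlim)) (htf : ∀ n, GroupTorsionFree (Γ n).carrier) :
    GroupTorsionFree Γlim.carrier := by
  intro g hg
  obtain ⟨w, rfl⟩ := Γlim.eval_surjective g
  obtain ⟨k, hk, hwk⟩ := isOfFinOrder_iff_pow_eq_one.1 hg
  rw [← map_pow] at hwk
  -- Torsion is witnessed by two words: `w ^ k` is a relation and `w` is not.
  obtain ⟨n, hn, hn'⟩ := ((eventually_eval_eq_one_iff hlim (w ^ k)).and
    (eventually_eval_eq_one_iff hlim w)).exists
  refine hn'.1 (htf n _ (isOfFinOrder_iff_pow_eq_one.2 ⟨k, hk, ?_⟩))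
  rw [← map_pow]
  exact hn.2 hwk

end MarkedGroup

theorem exists_int_eq_of_tendsto {u : ℕ → ℝ} {x : ℝ} (hu : ∀ n, ∃ k : ℤ, u n = k)
    (h : Tendsto u atTop (𝓝 x)) : ∃ k : ℤ, x = k := by
  have hc : IsClosed (Set.range ((↑) : ℤ → ℝ)) := Int.isClosedEmbedding_coe_real.isClosed_range
  obtain ⟨k, hk⟩ := hc.mem_of_tendsto h (Eventually.of_forall fun n => by
    obtain ⟨k, hk⟩ := hu n
    exact ⟨k, hk.symm⟩)
  exact ⟨k, hk.symm⟩

end Convergence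

open Filter in
theorem theorem6p6 {m : ℕ} (Γ : ℕ → MarkedGroup.{u} m) (Γlim : MarkedGroup.{u} m)
    (hlim : Tendsto Γ atTop (𝓝 Γlim))
    (htf : ∀ n, GroupTorsionFree (Γ n).carrier)
    (hsofic : ∀ n, IsSofic (Γ n).carrier)
    (hAtiyah : ∀ n, AtiyahConjecture (Γ n).carrier) :
    (∀ (d : ℕ) (A : Matrix (Fin d) (Fin d) (MonoidAlgebra ℤ (FreeGroup (Fin m)))),
      Tendsto (fun n => vnDimKer ((Γ n).evalMatrix A)) atTop (𝓝 (vnDimKer (Γlim.evalMatrix A)))) ∧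
    GroupTorsionFree Γlim.carrier ∧ AtiyahConjecture Γlim.carrier := by
  refine ⟨fun d A => MarkedGroup.tendsto_vnDimKer_evalMatrix hlim hsofic A,
    MarkedGroup.groupTorsionFree_of_tendsto hlim htf, fun _ d B _ _ => ?_⟩
  obtain ⟨A, rfl⟩ := Γlim.exists_evalMatrix_eq B
  exact exists_int_eq_of_tendsto (fun n => (hAtiyah n).exists_vnDimKer_eq (htf n) _)
    (MarkedGroup.tendsto_vnDimKer_evalMatrix hlim hsofic A)
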